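/- Setting. Let $(E,d_E)$ and $(\Sigma,d_\Sigma)$ be complete separable metric spaces with Borel $\sigma$-fields $\mathcal E$, $\mathcal S$; let $\mathcal M_1(\cdot)$ denote the set of Borel probability measures on a space. Put $\Omega=E^{\mathbb N}$, $\mathcal F=\mathcal E^{\otimes\mathbb N}$, $\mathbb N=\{1,2,\dots\}$, and let $X_i$ be the $i$-th coordinate projection. For $x_1,\dots,x_n\in E$ let $\widehat m_n(x_1,\dots,x_n)=\frac1n\sum_{i=1}^n\delta_{x_i}$. Let $\psi:E\to[1,\infty)$ be continuous and let $\mathcal M_1^\psi(E)$ be the set of $\mu\in\mathcal M_1(E)$ with $\int\psi\,d\mu<\infty$. Let $\Theta\subset\mathcal M_1^\psi(E)$ contain all empirical measures $\widehat m_n(x_1,\dots,x_n)$, $n\in\mathbb N$, $x_1,\dots,x_n\in E$. For every $\mu\in\Theta$ let $\mathbb P^\mu$ be a probability measure on $(\Omega,\mathcal F)$ with $\mathbb P^\mu\circ X_i^{-1}=\mu$ for all $i\in\mathbb N$. Let $T_n:\Theta\to\Sigma$, $n\in\mathbb N$, be maps, put $\widehat t_n(x_1,\dots,x_n)=T_n(\widehat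 m_n(x_1,\dots,x_n))$ on $E^n$ and $\widehat T_n(x)=\widehat t_n(x_1,\dots,x_n)$ for $x=(x_1,x_2,\dots)\in\Omega$, and assume that each $\widehat T_n:\Omega\to\Sigma$ is measurable. Metrics. Let $d_{\mathrm w}$ be any metric on $\mathcal M_1(E)$ which metrizes the weak topology and put $d_\psi(\mu_1,\mu_2)=d_{\mathrm w}(\mu_1,\mu_2)+|\int\psi\,d\mu_1-\int\psi\,d\mu_2|$. Let $d_\Theta$ be any metric on $\Theta$ which generates the relative weak topology, let $\rho$ be any metric on $\mathcal M_1(\Sigma)$ which metrizes the weak topology, and let $\rho_n$ be any metric on $\mathcal M_1(E^n)$ which metrizes the weak topology. Equip $E^n$ with $d_n(x,y)=\max_{1\le i\le n}d_E(x_i,y_i)$. Let $\rho_{\mathrm P}(\mu_1,\mu_2)=\inf\{\varepsilon>0:\mu_1[A]\le\mu_2[A^\varepsilon]+\varepsilon\text{ for all }A\in\mathcal S\}$, where $A^\varepsilon=\{s\in\Sigma:\inf_{a\in A}d_\Sigma(s,a)\le\varepsilon\}$, be the Prohorov metric on $\mathcal M_1(\Sigma)$. Terminology. Let $\Theta_0\subset\Theta$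 and let $\rho'$ be a metric on $\mathcal M_1(\Sigma)$. * $(T_n)$ is asymptotically $(d_\psi,d_\Sigma)$-continuous if for every $\mu_1\in\Theta$ and $\varepsilon>0$ there are $\delta>0$ and $n_0\in\mathbb N$ such that $d_\Sigma(T_n(\mu_1),T_n(\mu_2))\le\varepsilon$ for all $n\ge n_0$ and all $\mu_2\in\Theta$ with $d_\psi(\mu_1,\mu_2)\le\delta$. * $(\widehat T_n)$ is asymptotically $(d_\Theta,\rho')$-robust on $\Theta_0$ if for every $\mu_1\in\Theta_0$ and $\varepsilon>0$ there are $\delta>0$ and $n_0\in\mathbb N$ such that $\rho'(\mathbb P^{\mu_1}\circ\widehat T_n^{-1},\mathbb P^{\mu_2}\circ\widehat T_n^{-1})\le\varepsilon$ for all $n\ge n_0$ and all $\mu_2\in\Theta_0$ with $d_\Theta(\mu_1,\mu_2)\le\delta$. It is finite-sample $(d_\Theta,\rho')$-robust on $\Theta_0$ if for every $\mu_1\in\Theta_0$, $\varepsilon>0$ and $n_0\in\mathbb N$ there is $\delta>0$ such that the same inequality holds for all $1\le n\le n_0$ and all $\mu_2\in\Theta_0$ with $d_\Theta(\mu_1,\mu_2)\le\delta$.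 * $\Theta_0$ is locally uniformly $\psi$-integrating if for every $\mu_1\in\Theta_0$ and $\varepsilon>0$ there are $\delta>0$ and $a>0$ such that $\int\psi\mathbf 1_{\{\psi\ge a\}}\,d\mu_2\le\varepsilon$ for all $\mu_2\in\Theta_0$ with $d_\Theta(\mu_1,\mu_2)\le\delta$. * The strong mixing coefficients are $\alpha_n^\mu=\sup_{k\in\mathbb N}\sup\{|\mathbb P^\mu[A\cap B]-\mathbb P^\mu[A]\mathbb P^\mu[B]|:A\in\sigma(X_1,\dots,X_k),\,B\in\sigma(X_{n+k},X_{n+k+1},\dots)\}$. Theorem. The following three assertions hold. (i) Assume in addition that $E$ is locally compact. Let $\Theta_0\subset\Theta$, and assume that for every $\mu_1\in\Theta_0$ and $\varepsilon>0$ there are $\delta>0$ and $n_0\in\mathbb N$ such that $\alpha_n^{\mu_2}\le\varepsilon$ for all $n\ge n_0$ and all $\mu_2\in\Theta_0$ with $d_\Theta(\mu_1,\mu_2)\le\delta$. If $(T_n)$ is asymptotically $(d_\psi,d_\Sigma)$-continuous, then $(\widehat T_n)$ is asymptotically $(d_\Theta,\rho_{\mathrm P})$-robust on every locally uniformly $\psi$-integrating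 set $\Theta_1\subset\Theta_0$ (in particular on $\Theta_0$ itself if $\Theta_0$ is locally uniformly $\psi$-integrating). (ii) Let $\Theta_0\subset\Theta$, and assume that for every $n\in\mathbb N$ the mapping $\Theta_0\ni\mu\mapsto\mathbb P^\mu\circ(X_1,\dots,X_n)^{-1}$ is $(d_\Theta,\rho_n)$-continuous. If $\widehat t_n:E^n\to\Sigma$ is $(d_n,d_\Sigma)$-continuous for every $n\in\mathbb N$, then $(\widehat T_n)$ is finite-sample $(d_\Theta,\rho)$-robust on $\Theta_0$. (iii) Let $\Theta_0\subset\Theta$. Assume that $(\widehat T_n)$ is asymptotically $(d_\Theta,\rho)$-robust on $\Theta_0$ and that there is a map $T_0:\Theta_0\to\Sigma$ such that $\lim_{n\to\infty}\mathbb P^\mu[d_\Sigma(\widehat T_n,T_0(\mu))\ge\eta]=0$ for all $\eta>0$ and $\mu\in\Theta_0$. Then $T_0$ is $(d_\Theta,d_\Sigma)$-continuous. -/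

import Mathlib

open MeasureTheory Filter Topology
open scoped ENNReal

noncomputable section

namespace RobustPlugin

/-- `d` is a metric on the topological space `X` and the topology it generates is the given one. -/
structure Metrizes {X : Type*} [TopologicalSpace X] (d : X → X → ℝ) : Prop where
  self_eq_zero : ∀ x, d x x = 0
  eq_of_eq_zero : ∀ x y, d x y = 0 → x = y
  symm : ∀ x y, d x y = d y x
  triangle : ∀ x y z, d x z ≤ d x y + d y z
  isOpen_iff : ∀ s : Set X, IsOpen s ↔ ∀ x ∈ s, ∃ ε > 0, ∀ y, d x y < ε → y ∈ s

/-- `(d, d')`-continuity of a map `f : X → Y`. -/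
def MetricContinuous {X Y : Type*} (d : X → X → ℝ) (d' : Y → Y → ℝ) (f : X → Y) : Prop :=
  ∀ x, ∀ ε > 0, ∃ δ > 0, ∀ y, d x y ≤ δ → d' (f x) (f y) ≤ ε

/-- Asymptotic `(d, d')`-continuity of a sequence of maps `V n : X → Y`, `n ≥ 1`. -/
def AsymptoticallyContinuous {X Y : Type*} (d : X → X → ℝ) (d' : Y → Y → ℝ)
    (V : ℕ+ → X → Y) : Prop :=
  ∀ x, ∀ ε > 0, ∃ δ > 0, ∃ n₀ : ℕ+, ∀ y, d x y ≤ δ → ∀ n ≥ n₀, d' (V n x) (V n y) ≤ ε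

section Robustness

variable {Par Ω S : Type*} [MeasurableSpace Ω] [MeasurableSpace S]

/-- Asymptotic `(d, ρ)`-robustness on `Θ₀` of the estimators `That n`, `n ≥ 1`, in the statistical
model `P`. -/
def AsymptoticallyRobust (d : Par → Par → ℝ)
    (ρ : ProbabilityMeasure S → ProbabilityMeasure S → ℝ) (P : Par → ProbabilityMeasure Ω)
    (That : ℕ+ → Ω → S) (hThat : ∀ n, Measurable (That n)) (Θ₀ : Set Par) : Prop :=
  ∀ θ₁ ∈ Θ₀, ∀ ε > 0, ∃ δ > 0, ∃ n₀ : ℕ+, ∀ θ₂ ∈ Θ₀, d θ₁ θ₂ ≤ δ → ∀ n ≥ n₀,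
    ρ ((P θ₁).map (hThat n).aemeasurable) ((P θ₂).map (hThat n).aemeasurable) ≤ ε

/-- Finite-sample `(d, ρ)`-robustness on `Θ₀` of the estimators `That n`, `n ≥ 1`, in the
statistical model `P`. -/
def FiniteSampleRobust (d : Par → Par → ℝ)
    (ρ : ProbabilityMeasure S → ProbabilityMeasure S → ℝ) (P : Par → ProbabilityMeasure Ω)
    (That : ℕ+ → Ω → S) (hThat : ∀ n, Measurable (That n)) (Θ₀ : Set Par) : Prop :=
  ∀ θ₁ ∈ Θ₀, ∀ ε > 0, ∀ n₀ : ℕ+, ∃ δ > 0, ∀ θ₂ ∈ Θ₀, d θ₁ θ₂ ≤ δ → ∀ n ≤ n₀,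
    ρ ((P θ₁).map (hThat n).aemeasurable) ((P θ₂).map (hThat n).aemeasurable) ≤ ε

end Robustness

/-- The Prohorov metric. Here `Metric.cthickening ε A` is the set of points whose distance to `A`
is at most `ε` (and it is empty if `A` is empty). -/
def prohorovDist {S : Type*} [MetricSpace S] [MeasurableSpace S]
    (μ₁ μ₂ : ProbabilityMeasure S) : ℝ :=
  sInf {ε : ℝ | 0 < ε ∧ ∀ A : Set S, MeasurableSet A →
    (μ₁ : Measure S) A ≤ (μ₂ : Measure S) (Metric.cthickening ε A) + ENNReal.ofReal ε}

section Sample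

variable {E : Type*} [MeasurableSpace E]

/-- The empirical probability measure `(1/n) ∑ δ_{x_i}` of order `n ≥ 1`. -/
def empiricalMeasure (n : ℕ+) (x : Fin n → E) : ProbabilityMeasure E :=
  ⟨((n : ℕ) : ℝ≥0∞)⁻¹ • ∑ i, Measure.dirac (x i), by
    constructor
    simp only [Measure.smul_apply, Measure.coe_finsetSum, Finset.sum_apply, measure_univ,
      Finset.sum_const, Finset.card_univ, Fintype.card_fin, smul_eq_mul, nsmul_eq_mul, mul_one]
    exact ENNReal.inv_mul_cancel (by simp) (ENNReal.natCast_ne_top _)⟩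

/-- The first `n` observations. The sample space is `ℕ → E`, the coordinate with index `i`
being the observation `X_{i+1}`. -/
def firstObs (n : ℕ+) (ω : ℕ → E) : Fin n → E := fun i => ω i

theorem measurable_firstObs (n : ℕ+) : Measurable (firstObs (E := E) n) :=
  measurable_pi_lambda _ fun i => measurable_pi_apply (i : ℕ)

/-- The map `(x_1, …, x_n) ↦ T_n(m_n(x_1, …, x_n))`, with `m_n` the empirical measure. -/
def plugInMap {S : Type*} {Θ : Set (ProbabilityMeasure E)}
    (hΘ : ∀ (n : ℕ+) (x : Fin n → E), empiricalMeasure n x ∈ Θ) (T : ℕ+ → Θ → S)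
    (n : ℕ+) (x : Fin n → E) : S :=
  T n ⟨empiricalMeasure n x, hΘ n x⟩

/-- The plug-in estimator of sample size `n`, as a map on the sample space. -/
def plugInEstimator {S : Type*} {Θ : Set (ProbabilityMeasure E)}
    (hΘ : ∀ (n : ℕ+) (x : Fin n → E), empiricalMeasure n x ∈ Θ) (T : ℕ+ → Θ → S)
    (n : ℕ+) (ω : ℕ → E) : S :=
  plugInMap hΘ T n (firstObs n ω)

/-- The σ-field generated by the observations with index at most `k`. -/
@[reducible] def pastField (k : ℕ) : MeasurableSpace (ℕ → E) :=
  ⨆ i ≤ k, MeasurableSpace.comap (fun ω : ℕ → E => ω i) inferInstance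

/-- The σ-field generated by the observations with index at least `k`. -/
@[reducible] def futureField (k : ℕ) : MeasurableSpace (ℕ → E) :=
  ⨆ i ≥ k, MeasurableSpace.comap (fun ω : ℕ → E => ω i) inferInstance

/-- The `n`-th strong mixing coefficient of the coordinate process under `Q`: the last index of the
past and the first index of the future differ by `n`. -/
def alphaMixing (Q : ProbabilityMeasure (ℕ → E)) (n : ℕ) : ℝ :=
  sSup {r : ℝ | ∃ (k : ℕ) (A B : Set (ℕ → E)),
    MeasurableSet[pastField k] A ∧ MeasurableSet[futureField (k + n)] B ∧
    r = |(Q : Measure (ℕ → E)).real (A ∩ B)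
          - (Q : Measure (ℕ → E)).real A * (Q : Measure (ℕ → E)).real B|}

/-- The probability measures that integrate the gauge function `ψ`. -/
def probWithMoment (ψ : E → ℝ) : Set (ProbabilityMeasure E) :=
  {μ | Integrable ψ (μ : Measure E)}

/-- The metric `d_ψ` built from a metric `dw`. -/
def dPsi (dw : ProbabilityMeasure E → ProbabilityMeasure E → ℝ) (ψ : E → ℝ)
    (μ₁ μ₂ : ProbabilityMeasure E) : ℝ :=
  dw μ₁ μ₂ + |∫ x, ψ x ∂(μ₁ : Measure E) - ∫ x, ψ x ∂(μ₂ : Measure E)|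

/-- Locally uniformly `ψ`-integrating sets `Θ₀ ⊆ Θ`. In use, `d` is a metric generating the relative
weak topology of `Θ`, so that its restriction to `Θ₀` generates the relative weak topology of
`Θ₀`. -/
def LocallyUniformlyIntegrating {Θ : Set (ProbabilityMeasure E)} (d : Θ → Θ → ℝ) (ψ : E → ℝ)
    (Θ₀ : Set Θ) : Prop :=
  ∀ μ₁ ∈ Θ₀, ∀ ε > 0, ∃ δ > 0, ∃ a > 0, ∀ μ₂ ∈ Θ₀, d μ₁ μ₂ ≤ δ →
    ∫⁻ x in {x | a ≤ ψ x}, ENNReal.ofReal (ψ x) ∂(μ₂.1 : Measure E) ≤ ENNReal.ofReal ε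

end Sample

end RobustPlugin

end

/-! Assertion (i) is a uniform law of large numbers. Under `P μ₂`, with `μ₂` in `Θ₁` near `μ₁` and
`n` large, the empirical measure is `dPsi`-close to `μ₁` with high probability, uniformly in `μ₂`.
Asymptotic continuity at `μ₁` then puts the estimator near the point `T n μ₁` under both `P μ₁` and
`P μ₂`. Two laws that nearly live on one small ball are Prohorov close
(`prohorovDist_le_of_closedBall`); it does not matter that the centre moves with `n`.

The uniform law rests on Chebyshev's inequality: mixing controls the covariances of a bounded
function of the observations (`covariance_le_alphaMixing`), hence the variance of its mean
(`variance_sum_le`). Truncation and uniform integrability extend the law to `ψ`. Statements holding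
with high probability as `μ₂` tends to `μ₁` and `n` to infinity are phrased as convergence along the
filter `probFilter`, so weak convergence can be tested one function at a time.

Assertion (ii) is the continuous mapping theorem for each `n`. For (iii), consistency makes the laws
of the estimators converge to Dirac masses, robustness compares these in the limit, and the
embedding of points as Dirac masses carries closeness back to `S`. -/

namespace RobustPlugin

/-! ### Neighbourhoods in terms of an arbitrary metrizing function -/

namespace Metrizes

variable {X : Type*} [TopologicalSpace X] {d : X → X → ℝ}

/-- Robustness and continuity are defined with `≤ δ`, the topology with strict balls; halving the
radius reconciles them. This turns the quantifiers over `δ` into filter statements. -/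
theorem eventually_nhds_iff (hd : Metrizes d) {x : X} {p : X → Prop} :
    (∀ᶠ y in 𝓝 x, p y) ↔ ∃ δ > 0, ∀ y, d x y ≤ δ → p y := by
  rw [_root_.eventually_nhds_iff]
  constructor
  · rintro ⟨s, hs, hso, hxs⟩
    obtain ⟨ε, hε, h⟩ := (hd.isOpen_iff s).1 hso x hxs
    exact ⟨ε / 2, by positivity, fun y hy => hs y (h y (by linarith))⟩
  · rintro ⟨δ, hδ, h⟩
    refine ⟨{y | d x y < δ}, fun y hy => h y (le_of_lt hy), (hd.isOpen_iff _).2 ?_,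
      by simpa [hd.self_eq_zero] using hδ⟩
    intro y hy
    refine ⟨δ - d x y, sub_pos.2 hy, fun z hz => ?_⟩
    have := hd.triangle x y z
    simp only [Set.mem_ofPred_eq]
    linarith

theorem eventually_nhdsWithin_iff (hd : Metrizes d) {x : X} {s : Set X} {p : X → Prop} :
    (∀ᶠ y in 𝓝[s] x, p y) ↔ ∃ δ > 0, ∀ y ∈ s, d x y ≤ δ → p y := by
  rw [_root_.eventually_nhdsWithin_iff, hd.eventually_nhds_iff]
  exact ⟨fun ⟨δ, hδ, h⟩ => ⟨δ, hδ, fun y hs hy => h y hy hs⟩,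
    fun ⟨δ, hδ, h⟩ => ⟨δ, hδ, fun y hy hs => h y hs hy⟩⟩

theorem eventually_le (hd : Metrizes d) (x : X) {ε : ℝ} (hε : 0 < ε) :
    ∀ᶠ y in 𝓝 x, d x y ≤ ε :=
  hd.eventually_nhds_iff.2 ⟨ε, hε, fun _ h => h⟩

end Metrizes

/-! ### Finite-sample robustness -/

theorem finiteSampleRobust_of_continuous {E : Type*} [MetricSpace E] [SecondCountableTopology E]
    [MeasurableSpace E] [BorelSpace E] {S : Type*} [MetricSpace S] [MeasurableSpace S]
    [BorelSpace S] {Par : Type*} {d : Par → Par → ℝ} {P : Par → ProbabilityMeasure (ℕ → E)}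
    {ρ : ProbabilityMeasure S → ProbabilityMeasure S → ℝ} (hρ : Metrizes ρ)
    {ρn : ∀ n : ℕ+, ProbabilityMeasure (Fin n → E) → ProbabilityMeasure (Fin n → E) → ℝ}
    (hρn : ∀ n, Metrizes (ρn n)) {t : ∀ n : ℕ+, (Fin n → E) → S}
    (hT : ∀ n, Measurable fun ω => t n (firstObs n ω)) {Θ₀ : Set Par}
    (hP : ∀ n : ℕ+, MetricContinuous (fun μ₁ μ₂ : Θ₀ => d μ₁ μ₂) (ρn n)
        (fun μ : Θ₀ => (P μ).map (measurable_firstObs n).aemeasurable))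
    (ht : ∀ n, Continuous (t n)) :
    FiniteSampleRobust d ρ P (fun n ω => t n (firstObs n ω)) hT Θ₀ := by
  intro μ₁ h₁ ε hε n₀
  have key : ∀ n : ℕ+, ∃ δ > 0, ∀ μ₂ ∈ Θ₀, d μ₁ μ₂ ≤ δ →
      ρ ((P μ₁).map (hT n).aemeasurable) ((P μ₂).map (hT n).aemeasurable) ≤ ε := by
    intro n
    -- The law of the estimator is the image of the law of the first `n` observations under `t n`,
    -- and pushforward along a continuous map is weakly continuous.
    have hmap : ∀ μ, (P μ).map (hT n).aemeasurable =
        ((P μ).map (measurable_firstObs n).aemeasurable).map (ht n).measurable.aemeasurable := by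
      intro μ
      apply Subtype.ext
      simp only [ProbabilityMeasure.toMeasure_map, ProbabilityMeasure.val_eq_to_measure]
      rw [Measure.map_map (ht n).measurable (measurable_firstObs n)]
      rfl
    have hc := (ProbabilityMeasure.continuous_map (ht n)).continuousAt.eventually
      (hρ.eventually_le (((P μ₁).map (measurable_firstObs n).aemeasurable).map
        (ht n).measurable.aemeasurable) hε)
    obtain ⟨e, he, h⟩ := (hρn n).eventually_nhds_iff.1 hc
    obtain ⟨δ, hδ, h'⟩ := hP n ⟨μ₁, h₁⟩ e he
    refine ⟨δ, hδ, fun μ₂ h₂ hd => ?_⟩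
    rw [hmap, hmap]
    exact h _ (h' ⟨μ₂, h₂⟩ hd)
  choose δ hδ h using key
  have hne : (Finset.Icc 1 n₀).Nonempty := ⟨1, by simp⟩
  refine ⟨(Finset.Icc 1 n₀).inf' hne δ, ?_, fun μ₂ h₂ hd n hn => h n μ₂ h₂ (hd.trans ?_)⟩
  · simpa [Finset.lt_inf'_iff] using fun i _ => hδ i
  · exact Finset.inf'_le _ (by simpa using hn)

/-! ### Consistency and robustness imply continuity of the limit -/

theorem tendsto_map_diracProba {Ω S ι : Type*} [MeasurableSpace Ω] [PseudoMetricSpace S]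
    [SecondCountableTopology S] [MeasurableSpace S] [BorelSpace S] {l : Filter ι} {Q : ProbabilityMeasure Ω} {X : ι → Ω → S}
    (hX : ∀ i, Measurable (X i)) {c : S}
    (h : ∀ η > 0, Tendsto (fun i => (Q : Measure Ω) {ω | η ≤ dist (X i ω) c}) l (𝓝 0)) :
    Tendsto (fun i => Q.map (hX i).aemeasurable) l (𝓝 (diracProba c)) := by
  rw [ProbabilityMeasure.tendsto_iff_forall_integral_tendsto]
  intro f
  have hdirac : ∫ s, f s ∂(diracProba c : Measure S) = f c := by
    simp [diracProba, integral_dirac' _ _ f.continuous.stronglyMeasurable]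
  rw [hdirac, Metric.tendsto_nhds]
  intro ε hε
  -- Where `X i` is within `η` of `c`, the error in `f` is below `ε / 2`; elsewhere it is at most `2
  -- * ‖f‖`, on a set of vanishing probability.
  obtain ⟨η, hη, hf⟩ := Metric.continuousAt_iff.1 f.continuous.continuousAt (ε / 2) (by positivity)
  have hlim : Tendsto (fun i => ε / 2 + 2 * ‖f‖ * (Q : Measure Ω).real {ω | η ≤ dist (X i ω) c})
      l (𝓝 (ε / 2 + 2 * ‖f‖ * 0)) :=
    (((ENNReal.tendsto_toReal ENNReal.zero_ne_top).comp (h η hη)).const_mul _).const_add _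
  filter_upwards [hlim.eventually_lt_const (show ε / 2 + 2 * ‖f‖ * 0 < ε by linarith)] with i hi
  have hm : MeasurableSet {ω | η ≤ dist (X i ω) c} :=
    measurableSet_le measurable_const ((hX i).dist measurable_const)
  have hint : Integrable (fun ω => f (X i ω)) (Q : Measure Ω) :=
    .of_bound (f.continuous.measurable.comp (hX i)).aestronglyMeasurable ‖f‖
      (.of_forall fun ω => f.norm_coe_le_norm _)
  rw [ProbabilityMeasure.toMeasure_map, integral_map (hX i).aemeasurable
    f.continuous.stronglyMeasurable.aestronglyMeasurable, Real.dist_eq]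
  refine lt_of_le_of_lt ?_ hi
  calc |∫ ω, f (X i ω) ∂(Q : Measure Ω) - f c|
      = |∫ ω, (f (X i ω) - f c) ∂(Q : Measure Ω)| := by
        rw [integral_sub hint (integrable_const _)]; simp
    _ ≤ ∫ ω, |f (X i ω) - f c| ∂(Q : Measure Ω) := abs_integral_le_integral_abs
    _ ≤ ∫ ω, (ε / 2 + {ω | η ≤ dist (X i ω) c}.indicator (fun _ => 2 * ‖f‖) ω)
          ∂(Q : Measure Ω) := by
        refine integral_mono (hint.sub (integrable_const _)).abs
          ((integrable_const _).add ((integrable_const _).indicator hm)) fun ω => ?_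
        by_cases hω : η ≤ dist (X i ω) c
        · have := f.dist_le_two_norm (X i ω) c
          rw [Real.dist_eq] at this
          simp only [Set.indicator, Set.mem_ofPred_eq, hω, if_true]
          linarith
        · have := hf (not_le.1 hω)
          rw [Real.dist_eq] at this
          simp only [Set.indicator, Set.mem_ofPred_eq, hω, if_false]
          linarith
    _ = _ := by
        rw [integral_add (integrable_const _) ((integrable_const _).indicator hm),
          integral_indicator_const _ hm]
        simp [mul_comm]

theorem metricContinuous_of_asymptoticallyRobust {Ω S : Type*} [MeasurableSpace Ω] [MetricSpace S]
    [SecondCountableTopology S]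
    [MeasurableSpace S] [BorelSpace S] {Par : Type*} {d : Par → Par → ℝ}
    {P : Par → ProbabilityMeasure Ω}
    {ρ : ProbabilityMeasure S → ProbabilityMeasure S → ℝ} (hρ : Metrizes ρ)
    {That : ℕ+ → Ω → S} (hT : ∀ n, Measurable (That n)) {Θ₀ : Set Par}
    (hrob : AsymptoticallyRobust d ρ P That hT Θ₀) (T₀ : Θ₀ → S)
    (hcons : ∀ η > 0, ∀ μ : Θ₀, Tendsto (fun n : ℕ+ => (P μ : Measure Ω)
      {ω | η ≤ dist (That n ω) (T₀ μ)}) atTop (𝓝 0)) :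
    MetricContinuous (fun μ₁ μ₂ : Θ₀ => d μ₁ μ₂) dist T₀ := by
  rintro ⟨μ₁, h₁⟩ ε hε
  have hlim : ∀ μ : Θ₀, ∀ e > 0, ∀ᶠ n in atTop,
      ρ (diracProba (T₀ μ)) ((P μ).map (hT n).aemeasurable) ≤ e := fun μ e he =>
    (tendsto_map_diracProba hT fun η hη => hcons η hη μ).eventually (hρ.eventually_le _ he)
  have hball : ∀ᶠ s in 𝓝 (T₀ ⟨μ₁, h₁⟩), dist (T₀ ⟨μ₁, h₁⟩) s ≤ ε := by
    filter_upwards [Metric.closedBall_mem_nhds (T₀ ⟨μ₁, h₁⟩) hε] with s hs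
    rwa [dist_comm]
  rw [isEmbedding_diracProba.isInducing.nhds_eq_comap, eventually_comap,
    hρ.eventually_nhds_iff] at hball
  obtain ⟨e, he, hball⟩ := hball
  obtain ⟨δ, hδ, n₀, h⟩ := hrob μ₁ h₁ (e / 3) (by positivity)
  refine ⟨δ, hδ, fun ⟨μ₂, h₂⟩ hd => hball _ ?_ _ rfl⟩
  -- The index `n` may depend on `μ₂`, since consistency is only pointwise; `δ` was fixed beforehand
  -- by robustness.
  obtain ⟨n, hn₁, hn₂, hn⟩ := ((hlim ⟨μ₁, h₁⟩ (e / 3) (by positivity)).and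
    ((hlim ⟨μ₂, h₂⟩ (e / 3) (by positivity)).and (eventually_ge_atTop n₀))).exists
  have h12 := h μ₂ h₂ hd n hn
  have t₁ := hρ.triangle (diracProba (T₀ ⟨μ₁, h₁⟩)) ((P μ₁).map (hT n).aemeasurable)
    (diracProba (T₀ ⟨μ₂, h₂⟩))
  have t₂ := hρ.triangle ((P μ₁).map (hT n).aemeasurable) ((P μ₂).map (hT n).aemeasurable)
    (diracProba (T₀ ⟨μ₂, h₂⟩))
  rw [hρ.symm ((P μ₂).map (hT n).aemeasurable)] at t₂
  simp only at hn₁ hn₂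
  linarith

/-- Two laws that are both nearly concentrated on a small ball are close in the Prohorov metric. -/
theorem prohorovDist_le_of_closedBall {S : Type*} [MetricSpace S] [MeasurableSpace S]
    [BorelSpace S] {μ₁ μ₂ : ProbabilityMeasure S} {c : S} {ε : ℝ} (hε : 0 < ε)
    (h₁ : (μ₁ : Measure S) (Metric.closedBall c (ε / 2))ᶜ ≤ ENNReal.ofReal (ε / 2))
    (h₂ : (μ₂ : Measure S) (Metric.closedBall c (ε / 2))ᶜ ≤ ENNReal.ofReal (ε / 2)) :
    prohorovDist μ₁ μ₂ ≤ ε := by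
  refine csInf_le ⟨0, fun x hx => hx.1.le⟩ ⟨hε, fun A hA => ?_⟩
  -- If `A` meets the ball, the `ε`-thickening of `A` contains the whole ball, any two points of
  -- which are at distance at most `ε`. Otherwise `A` lies in the complement, where `μ₁` is small.
  by_cases hne : (A ∩ Metric.closedBall c (ε / 2)).Nonempty
  · obtain ⟨a, haA, hac⟩ := hne
    have hsub : Metric.closedBall c (ε / 2) ⊆ Metric.cthickening ε A := fun s hs =>
      Metric.mem_cthickening_of_dist_le s a ε A haA (by
        have := dist_triangle_right s a c
        rw [Metric.mem_closedBall] at hs hac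
        linarith)
    calc (μ₁ : Measure S) A ≤ 1 := prob_le_one
      _ = (μ₂ : Measure S) (Metric.closedBall c (ε / 2))
          + (μ₂ : Measure S) (Metric.closedBall c (ε / 2))ᶜ := by
        rw [measure_add_measure_compl Metric.isClosed_closedBall.measurableSet, measure_univ]
      _ ≤ _ := add_le_add (measure_mono hsub) (h₂.trans (ENNReal.ofReal_le_ofReal (by linarith)))
  · have hsub : A ⊆ (Metric.closedBall c (ε / 2))ᶜ := fun s hs hc => hne ⟨s, hs, hc⟩
    calc (μ₁ : Measure S) A ≤ ENNReal.ofReal (ε / 2) := (measure_mono hsub).trans h₁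
      _ ≤ ENNReal.ofReal ε := ENNReal.ofReal_le_ofReal (by linarith)
      _ ≤ _ := le_add_self

/-! ### Covariance inequality for bounded functions -/

/-- Layer cake: the integral of `U` is the integral over `t` in `(0, c]` of the measure of `{t ≤
U}`, so a bound on sets gains only the factor `c`. -/
theorem abs_integral_sub_integral_le {Ω : Type*} {m m0 : MeasurableSpace Ω} (hm : m ≤ m0)
    {κ₁ κ₂ : Measure[m0] Ω} [IsFiniteMeasure κ₁] [IsFiniteMeasure κ₂] {α c : ℝ} (hc : 0 ≤ c)
    (h : ∀ A, MeasurableSet[m] A → |κ₁.real A - κ₂.real A| ≤ α)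
    {U : Ω → ℝ} (hU : Measurable[m] U) (hU₀ : ∀ ω, 0 ≤ U ω) (hUc : ∀ ω, U ω ≤ c) :
    |∫ ω, U ω ∂κ₁ - ∫ ω, U ω ∂κ₂| ≤ c * α := by
  have hint : ∀ (κ : Measure[m0] Ω) [IsFiniteMeasure κ], Integrable U κ := fun κ _ =>
    .of_bound (hU.mono hm le_rfl).aestronglyMeasurable c
      (.of_forall fun ω => by rw [Real.norm_of_nonneg (hU₀ ω)]; exact hUc ω)
  have hanti : ∀ (κ : Measure[m0] Ω) [IsFiniteMeasure κ],
      IntegrableOn (fun t => κ.real {ω | t ≤ U ω}) (Set.Ioc 0 c) := fun κ _ =>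
    ((show Antitone fun t => κ.real {ω | t ≤ U ω} from fun s t hst =>
      measureReal_mono fun ω hω => le_trans hst hω).antitoneOn _).integrableOn_isCompact
      isCompact_Icc |>.mono_set Set.Ioc_subset_Icc_self
  have hlayer : ∀ (κ : Measure[m0] Ω) [IsFiniteMeasure κ],
      ∫ ω, U ω ∂κ = ∫ t in Set.Ioc 0 c, κ.real {ω | t ≤ U ω} := fun κ _ =>
    (hint κ).integral_eq_integral_Ioc_meas_le (.of_forall hU₀) (.of_forall hUc)
  rw [hlayer κ₁, hlayer κ₂, ← integral_sub (hanti κ₁) (hanti κ₂)]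
  have := norm_setIntegral_le_of_norm_le_const (μ := volume) (s := Set.Ioc 0 c)
    (f := fun t => κ₁.real {ω | t ≤ U ω} - κ₂.real {ω | t ≤ U ω}) (C := α) (by simp)
    fun t _ => h {ω | t ≤ U ω} (hU measurableSet_Ici)
  simpa [hc, mul_comm] using this

/-- The comparison of integrals is used twice. For fixed `B`, comparing `Q` restricted to `B` with
`Q B • Q` on `m₁` replaces the indicator of `A` by `U`. The result is a bound on sets of `m₂` for
`Q` with density `U` against a multiple of `Q`, and a second use replaces the indicator of `B` by
`V`. -/
theorem abs_integral_mul_sub_le {Ω : Type*} {m₁ m₂ m0 : MeasurableSpace Ω} (hm₁ : m₁ ≤ m0)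
    (hm₂ : m₂ ≤ m0) {Q : Measure[m0] Ω} [IsProbabilityMeasure Q] {α c d : ℝ} (hc : 0 ≤ c)
    (hd : 0 ≤ d) (h : ∀ A B, MeasurableSet[m₁] A → MeasurableSet[m₂] B →
      |Q.real (A ∩ B) - Q.real A * Q.real B| ≤ α)
    {U V : Ω → ℝ} (hU : Measurable[m₁] U) (hU₀ : ∀ ω, 0 ≤ U ω) (hUc : ∀ ω, U ω ≤ c)
    (hV : Measurable[m₂] V) (hV₀ : ∀ ω, 0 ≤ V ω) (hVd : ∀ ω, V ω ≤ d) :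
    |∫ ω, U ω * V ω ∂Q - (∫ ω, U ω ∂Q) * ∫ ω, V ω ∂Q| ≤ d * (c * α) := by
  have hU' : Measurable[m0] U := hU.mono hm₁ le_rfl
  have hUint : Integrable U Q := .of_bound hU'.aestronglyMeasurable c
      (.of_forall fun ω => by rw [Real.norm_of_nonneg (hU₀ ω)]; exact hUc ω)
  have hU'' : Measurable[m0] fun ω => ENNReal.ofReal (U ω) := hU'.ennreal_ofReal
  have hlt : ∀ᵐ ω ∂Q, ENNReal.ofReal (U ω) < ∞ := .of_forall fun ω => ENNReal.ofReal_lt_top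
  have hfin : IsFiniteMeasure (Q.withDensity fun ω => ENNReal.ofReal (U ω)) :=
    isFiniteMeasure_withDensity_ofReal hUint.2
  have hI₀ : 0 ≤ ∫ ω, U ω ∂Q := integral_nonneg hU₀
  have hfin₂ : IsFiniteMeasure (ENNReal.ofReal (∫ ω, U ω ∂Q) • Q) :=
    Q.smul_finite ENNReal.ofReal_ne_top
  have hset : ∀ B, MeasurableSet[m₂] B → |(Q.withDensity fun ω => ENNReal.ofReal (U ω)).real B
      - (ENNReal.ofReal (∫ ω, U ω ∂Q) • Q).real B| ≤ c * α := by
    intro B hB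
    have hfin₃ : IsFiniteMeasure (Q B • Q) := Q.smul_finite (measure_ne_top _ _)
    have key := abs_integral_sub_integral_le (κ₁ := Q.restrict B) (κ₂ := Q B • Q) hm₁ hc
      (fun A hA => by
        rw [measureReal_restrict_apply (hm₁ _ hA), measureReal_ennreal_smul_apply, mul_comm]
        exact h A B hA hB) hU hU₀ hUc
    have e₁ : (Q.withDensity fun ω => ENNReal.ofReal (U ω)).real B = ∫ ω in B, U ω ∂Q := by
      rw [measureReal_def, withDensity_apply _ (hm₂ _ hB),
        integral_eq_lintegral_of_nonneg_ae (.of_forall hU₀) hU'.aestronglyMeasurable]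
    rw [integral_smul_measure, smul_eq_mul] at key
    rw [e₁, measureReal_ennreal_smul_apply, ENNReal.toReal_ofReal hI₀, mul_comm (∫ ω, U ω ∂Q)]
    exact key
  have key := abs_integral_sub_integral_le hm₂ hd hset hV hV₀ hVd
  rw [integral_withDensity_eq_integral_toReal_smul hU'' hlt, integral_smul_measure,
    ENNReal.toReal_ofReal hI₀] at key
  simpa [ENNReal.toReal_ofReal (hU₀ _)] using key

/-! ### Variance of sums under strong mixing -/

section Mixing

variable {E : Type*} [MeasurableSpace E]

theorem alphaMixing_mem_le_one (Q : ProbabilityMeasure (ℕ → E)) (A B : Set (ℕ → E)) :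
    |(Q : Measure (ℕ → E)).real (A ∩ B)
      - (Q : Measure (ℕ → E)).real A * (Q : Measure (ℕ → E)).real B| ≤ 1 := by
  have h₁ : (Q : Measure (ℕ → E)).real (A ∩ B) ≤ 1 := measureReal_le_one
  have h₂ : (Q : Measure (ℕ → E)).real A ≤ 1 := measureReal_le_one
  have h₃ : (Q : Measure (ℕ → E)).real B ≤ 1 := measureReal_le_one
  have h₄ : 0 ≤ (Q : Measure (ℕ → E)).real (A ∩ B) := measureReal_nonneg
  have h₅ := mul_le_one₀ h₂ measureReal_nonneg h₃
  have h₆ : 0 ≤ (Q : Measure (ℕ → E)).real A * (Q : Measure (ℕ → E)).real B := by positivity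
  rw [abs_le]
  constructor <;> linarith

theorem le_alphaMixing (Q : ProbabilityMeasure (ℕ → E)) {n k : ℕ} {A B : Set (ℕ → E)}
    (hA : MeasurableSet[pastField k] A) (hB : MeasurableSet[futureField (k + n)] B) :
    |(Q : Measure (ℕ → E)).real (A ∩ B)
      - (Q : Measure (ℕ → E)).real A * (Q : Measure (ℕ → E)).real B| ≤ alphaMixing Q n :=
  le_csSup ⟨1, by rintro _ ⟨_, A, B, _, _, rfl⟩; exact alphaMixing_mem_le_one Q A B⟩
    ⟨k, A, B, hA, hB, rfl⟩

theorem alphaMixing_le_one (Q : ProbabilityMeasure (ℕ → E)) (n : ℕ) : alphaMixing Q n ≤ 1 :=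
  csSup_le ⟨_, 0, ∅, ∅, @MeasurableSet.empty _ (pastField 0),
    @MeasurableSet.empty _ (futureField (0 + n)), rfl⟩
    (by rintro _ ⟨_, A, B, _, _, rfl⟩; exact alphaMixing_mem_le_one Q A B)

theorem pastField_le (k : ℕ) : pastField (E := E) k ≤ MeasurableSpace.pi :=
  iSup₂_le fun i _ => (measurable_pi_apply i).comap_le

theorem futureField_le (k : ℕ) : futureField (E := E) k ≤ MeasurableSpace.pi :=
  iSup₂_le fun i _ => (measurable_pi_apply i).comap_le

theorem measurable_pastField (k : ℕ) : Measurable[pastField k] fun ω : ℕ → E => ω k :=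
  measurable_iff_comap_le.2 (le_iSup₂_of_le k le_rfl le_rfl)

theorem measurable_futureField (k : ℕ) : Measurable[futureField k] fun ω : ℕ → E => ω k :=
  measurable_iff_comap_le.2 (le_iSup₂_of_le k le_rfl le_rfl)

variable {f : E → ℝ} {M : ℝ}

theorem memLp_comp_eval (Q : ProbabilityMeasure (ℕ → E)) (hf : Measurable f)
    (hM : ∀ x, |f x| ≤ M) (i : ℕ) :
    MemLp (fun ω : ℕ → E => f (ω i)) 2 (Q : Measure (ℕ → E)) :=
  .of_bound (hf.comp (measurable_pi_apply i)).aestronglyMeasurable M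
    (.of_forall fun ω => hM (ω i))

theorem covariance_le_alphaMixing (Q : ProbabilityMeasure (ℕ → E)) (hf : Measurable f)
    (hM : ∀ x, |f x| ≤ M) (k n : ℕ) :
    ProbabilityTheory.covariance (fun ω : ℕ → E => f (ω k)) (fun ω => f (ω (k + n)))
      (Q : Measure (ℕ → E)) ≤ 4 * M ^ 2 * alphaMixing Q n := by
  have hLp := memLp_comp_eval Q hf hM
  have hLp' := memLp_comp_eval Q (f := fun x => f x + M) (M := 2 * M) (hf.add_const M)
    (fun x => by have := abs_le.1 (hM x); rw [abs_le]; constructor <;> linarith)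
  have hM₀ : 0 ≤ 2 * M := by
    obtain ⟨ω⟩ := Q.nonempty
    have := (abs_nonneg _).trans (hM (ω 0))
    linarith
  -- Adding `M` leaves the covariance unchanged and gives values in `[0, 2 * M]`, whence the factor
  -- `(2 * M) ^ 2`.
  rw [← ProbabilityTheory.covariance_add_const_left ((hLp k).integrable one_le_two) M,
    ← ProbabilityTheory.covariance_add_const_right ((hLp (k + n)).integrable one_le_two) M,
    ProbabilityTheory.covariance_eq_sub (hLp' k) (hLp' (k + n))]
  have := abs_integral_mul_sub_le (Q := (Q : Measure (ℕ → E))) (pastField_le k)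
    (futureField_le (k + n)) hM₀ hM₀ (fun A B hA hB => le_alphaMixing Q hA hB)
    (U := fun ω => f (ω k) + M) (V := fun ω => f (ω (k + n)) + M)
    ((hf.add_const M).comp (measurable_pastField k))
    (fun ω => by have := abs_le.1 (hM (ω k)); linarith)
    (fun ω => by have := abs_le.1 (hM (ω k)); linarith)
    ((hf.add_const M).comp (measurable_futureField (k + n)))
    (fun ω => by have := abs_le.1 (hM (ω (k + n))); linarith)
    (fun ω => by have := abs_le.1 (hM (ω (k + n))); linarith)
  refine (le_abs_self _).trans (this.trans_eq ?_)
  ring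

theorem variance_sum_le (Q : ProbabilityMeasure (ℕ → E)) (hf : Measurable f)
    (hM : ∀ x, |f x| ≤ M) {ε : ℝ} (hε : 0 ≤ ε) {k₀ : ℕ} (hα : ∀ k ≥ k₀, alphaMixing Q k ≤ ε)
    (n : ℕ) :
    ProbabilityTheory.variance (fun ω : ℕ → E => ∑ i : Fin n, f (ω i)) (Q : Measure (ℕ → E))
      ≤ 4 * M ^ 2 * (n * (2 * k₀) + n ^ 2 * ε) := by
  rw [ProbabilityTheory.variance_fun_sum fun i : Fin n => memLp_comp_eval Q hf hM i]
  -- The interval encodes `|i - j| < k₀`, also under truncated subtraction. At such lags only the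
  -- trivial bound 1 on the mixing coefficient is available, but each row has at most `2 * k₀` of
  -- them.
  have hcov : ∀ i j : ℕ, ProbabilityTheory.covariance (fun ω : ℕ → E => f (ω i))
      (fun ω => f (ω j)) (Q : Measure (ℕ → E)) ≤
      4 * M ^ 2 * ((if j ∈ Finset.Ico (i + 1 - k₀) (i + k₀) then 1 else 0) + ε) := by
    have key : ∀ k n : ℕ, alphaMixing Q n ≤ (if n < k₀ then 1 else 0) + ε := by
      intro k n
      split_ifs with h
      · linarith [alphaMixing_le_one Q n]
      · linarith [hα n (not_lt.1 h)]
    intro i j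
    rcases le_total i j with hij | hij
    · obtain ⟨n, rfl⟩ := Nat.exists_eq_add_of_le hij
      refine (covariance_le_alphaMixing Q hf hM i n).trans
        (mul_le_mul_of_nonneg_left ((key i n).trans_eq ?_) (by positivity))
      congr 2
      simp only [Finset.mem_Ico, eq_iff_iff]
      omega
    · obtain ⟨n, rfl⟩ := Nat.exists_eq_add_of_le hij
      rw [ProbabilityTheory.covariance_comm]
      refine (covariance_le_alphaMixing Q hf hM j n).trans
        (mul_le_mul_of_nonneg_left ((key j n).trans_eq ?_) (by positivity))
      congr 2
      simp only [Finset.mem_Ico, eq_iff_iff]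
      omega
  have hrow : ∀ i : ℕ, ∑ j : Fin n, (if (j : ℕ) ∈ Finset.Ico (i + 1 - k₀) (i + k₀) then (1 : ℝ)
      else 0) ≤ 2 * k₀ := by
    intro i
    rw [Fin.sum_univ_eq_sum_range
      (fun j => if j ∈ Finset.Ico (i + 1 - k₀) (i + k₀) then (1 : ℝ) else 0),
      Finset.sum_boole]
    have h₁ : ((Finset.range n).filter (· ∈ Finset.Ico (i + 1 - k₀) (i + k₀))).card ≤ 2 * k₀ :=
      (Finset.card_le_card fun j hj => (Finset.mem_filter.1 hj).2).trans (by
        rw [Nat.card_Ico]; omega)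
    exact_mod_cast h₁
  calc _ ≤ ∑ i : Fin n, ∑ j : Fin n, 4 * M ^ 2 *
        ((if (j : ℕ) ∈ Finset.Ico ((i : ℕ) + 1 - k₀) (i + k₀) then 1 else 0) + ε) :=
        Finset.sum_le_sum fun i _ => Finset.sum_le_sum fun j _ => hcov i j
    _ = 4 * M ^ 2 * ∑ i : Fin n, (∑ j : Fin n,
        (if (j : ℕ) ∈ Finset.Ico ((i : ℕ) + 1 - k₀) (i + k₀) then (1 : ℝ) else 0) + n * ε) := by
        simp_rw [Finset.mul_sum, ← Finset.mul_sum, Finset.sum_add_distrib]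
        simp
    _ ≤ 4 * M ^ 2 * ∑ i : Fin n, (2 * k₀ + n * ε) := by
        gcongr with i
        exact hrow i
    _ = _ := by
        simp only [Finset.sum_const, Finset.card_univ, Fintype.card_fin, nsmul_eq_mul]
        ring

/-- A quantitative weak law of large numbers for strongly mixing sequences. -/
theorem measure_le_abs_mean_sub_le (Q : ProbabilityMeasure (ℕ → E)) {μ : Measure E}
    (hQ : ∀ i, (Q : Measure (ℕ → E)).map (fun ω => ω i) = μ) (hf : Measurable f)
    (hM : ∀ x, |f x| ≤ M) {ε : ℝ} (hε : 0 ≤ ε) {k₀ : ℕ} (hα : ∀ k ≥ k₀, alphaMixing Q k ≤ ε)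
    {r : ℝ} (hr : 0 < r) (n : ℕ+) :
    (Q : Measure (ℕ → E)) {ω | r ≤ |(n : ℝ)⁻¹ * ∑ i : Fin n, f (ω i) - ∫ x, f x ∂μ|} ≤
      ENNReal.ofReal (4 * M ^ 2 * (2 * k₀ / n + ε) / r ^ 2) := by
  have hn : (0 : ℝ) < n := by exact_mod_cast n.pos
  have hLp := memLp_comp_eval Q hf hM
  have hmean : ∫ ω, (n : ℝ)⁻¹ * ∑ i : Fin n, f (ω i) ∂(Q : Measure (ℕ → E))
      = ∫ x, f x ∂μ := by
    have hi : ∀ i : ℕ, ∫ ω, f (ω i) ∂(Q : Measure (ℕ → E)) = ∫ x, f x ∂μ := fun i => by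
      rw [← hQ i, integral_map (measurable_pi_apply i).aemeasurable hf.aestronglyMeasurable]
    rw [integral_const_mul, integral_finsetSum _ fun (i : Fin n) _ => (hLp i).integrable one_le_two]
    simp only [hi, Finset.sum_const, Finset.card_univ, Fintype.card_fin, nsmul_eq_mul]
    field_simp
  have hcheb := ProbabilityTheory.meas_ge_le_variance_div_sq (μ := (Q : Measure (ℕ → E)))
    (X := fun ω => (n : ℝ)⁻¹ * ∑ i : Fin n, f (ω i))
    ((memLp_finsetSum _ fun (i : Fin n) _ => hLp i).const_mul _) hr
  rw [hmean, ProbabilityTheory.variance_const_mul] at hcheb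
  refine hcheb.trans (ENNReal.ofReal_le_ofReal (div_le_div_of_nonneg_right ?_ (sq_nonneg r)))
  refine (mul_le_mul_of_nonneg_left (variance_sum_le Q hf hM hε hα n)
    (by positivity)).trans_eq ?_
  field_simp

end Mixing

/-! ### Convergence in probability under varying laws -/

/-- The filter of the sets `C` such that the `Q i`-probability of the section of `C` at `i` tends
to one along `l`. -/
def probFilter {ι Ω : Type*} [MeasurableSpace Ω] (Q : ι → ProbabilityMeasure Ω) (l : Filter ι) :
    Filter (ι × Ω) where
  sets := {C | Tendsto (fun i => (Q i : Measure Ω) {ω | (i, ω) ∉ C}) l (𝓝 0)}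
  univ_sets := by simp [tendsto_const_nhds]
  sets_of_superset {C D} hC hCD := by
    refine tendsto_of_tendsto_of_tendsto_of_le_of_le tendsto_const_nhds hC (fun _ => zero_le)
      fun i => measure_mono fun ω hω h => hω (hCD h)
  inter_sets {C D} hC hD := by
    have h := Tendsto.add hC hD
    rw [add_zero] at h
    refine tendsto_of_tendsto_of_tendsto_of_le_of_le tendsto_const_nhds h (fun _ => zero_le)
      fun i => (measure_mono fun ω hω => ?_).trans (measure_union_le _ _)
    exact not_and_or.1 hω

section ProbFilter

variable {ι Ω : Type*} [MeasurableSpace Ω] {Q : ι → ProbabilityMeasure Ω} {l : Filter ι}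
  {p : ι × Ω → Prop}

theorem eventually_probFilter_iff : (∀ᶠ x in probFilter Q l, p x) ↔
    ∀ ε > 0, ∀ᶠ i in l, (Q i : Measure Ω) {ω | ¬ p (i, ω)} ≤ ENNReal.ofReal ε := by
  change Tendsto (fun i => (Q i : Measure Ω) {ω | ¬ p (i, ω)}) l (𝓝 0) ↔ _
  rw [ENNReal.tendsto_nhds_zero]
  refine ⟨fun h ε hε => h _ (ENNReal.ofReal_pos.2 hε), fun h ε hε => ?_⟩
  rcases eq_or_ne ε ∞ with rfl | hne
  · simp
  · simpa [ENNReal.ofReal_toReal hne] using h ε.toReal (ENNReal.toReal_pos hε.ne' hne)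

theorem eventually_probFilter_of_eventually {p : ι → Prop} (h : ∀ᶠ i in l, p i) :
    ∀ᶠ x in probFilter Q l, p x.1 := by
  refine eventually_probFilter_iff.2 fun ε _ => ?_
  filter_upwards [h] with i hi
  simp [hi]

end ProbFilter

/-! ### Uniform weak laws of large numbers -/

section Empirical

variable {E : Type*} [MeasurableSpace E]

theorem integral_empiricalMeasure (n : ℕ+) (x : Fin n → E) {f : E → ℝ} (hf : Measurable f) :
    ∫ y, f y ∂(empiricalMeasure n x : Measure E) = (n : ℝ)⁻¹ * ∑ i, f (x i) := by
  have hint : ∀ i ∈ Finset.univ, Integrable f (Measure.dirac (x i)) := fun i _ =>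
    integrable_dirac' hf.stronglyMeasurable (by simp)
  simp only [empiricalMeasure, ProbabilityMeasure.coe_mk]
  rw [integral_smul_measure, integral_finsetSum_measure hint]
  simp [integral_dirac' _ _ hf.stronglyMeasurable]

variable {Θ : Set (ProbabilityMeasure E)} {P : Θ → ProbabilityMeasure (ℕ → E)}
  {l : Filter Θ} {μ₁ : Θ}

/-- The uniform weak law of large numbers, for bounded functions. -/
theorem tendsto_mean_probFilter
    (hP : ∀ (μ : Θ) (i : ℕ), (P μ : Measure (ℕ → E)).map (fun ω => ω i) = (μ.1 : Measure E))
    (hα : ∀ ε > 0, ∃ k₀ : ℕ, ∀ᶠ μ in l, ∀ k ≥ k₀, alphaMixing (P μ) k ≤ ε)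
    {f : E → ℝ} (hf : Measurable f) {M : ℝ} (hM : ∀ x, |f x| ≤ M) {I : ℝ}
    (hlim : Tendsto (fun μ : Θ => ∫ x, f x ∂(μ.1 : Measure E)) l (𝓝 I)) :
    Tendsto (fun x : (Θ × ℕ+) × (ℕ → E) => (x.1.2 : ℝ)⁻¹ * ∑ i : Fin x.1.2, f (x.2 i))
      (probFilter (fun i => P i.1) (l ×ˢ atTop)) (𝓝 I) := by
  rw [Metric.tendsto_nhds]
  intro r hr
  have h₁ : ∀ᶠ x in probFilter (fun i : Θ × ℕ+ => P i.1) (l ×ˢ atTop),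
      |(∫ y, f y ∂(x.1.1.1 : Measure E)) - I| < r / 2 :=
    eventually_probFilter_of_eventually (p := fun i : Θ × ℕ+ =>
      |(∫ y, f y ∂(i.1.1 : Measure E)) - I| < r / 2)
      (tendsto_fst.eventually (Metric.tendsto_nhds.1 hlim (r / 2) (by positivity)))
  have h₂ : ∀ᶠ x in probFilter (fun i : Θ × ℕ+ => P i.1) (l ×ˢ atTop),
      |(x.1.2 : ℝ)⁻¹ * ∑ i : Fin x.1.2, f (x.2 i) - ∫ y, f y ∂(x.1.1.1 : Measure E)| < r / 2 := by
    refine eventually_probFilter_iff.2 fun ε hε => ?_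
    -- Solves the Chebyshev bound for `ε`: one `e` covers the mixing coefficients, the other the
    -- near-diagonal term `2 * k₀ / n`. The `+ 1` guards against `M = 0`.
    set e : ℝ := ε * (r / 2) ^ 2 / (4 * M ^ 2 + 1) / 2 with he
    have he₀ : 0 < e := by positivity
    obtain ⟨k₀, hk₀⟩ := hα e he₀
    have hn : Tendsto (fun n : ℕ+ => (2 * k₀ : ℝ) / n) atTop (𝓝 0) :=
      (tendsto_const_div_atTop_nhds_zero_nat (2 * k₀ : ℝ)).comp tendsto_PNat_val_atTop_atTop
    filter_upwards [tendsto_fst.eventually hk₀,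
      tendsto_snd.eventually (hn.eventually_le_const he₀)] with i hi hin
    simp only [not_lt]
    refine (measure_le_abs_mean_sub_le (P i.1) (hP i.1) hf hM he₀.le hi (half_pos hr) i.2).trans
      (ENNReal.ofReal_le_ofReal ?_)
    rw [div_le_iff₀ (by positivity)]
    calc 4 * M ^ 2 * (2 * k₀ / i.2 + e) ≤ (4 * M ^ 2 + 1) * (e + e) := by
          gcongr
          linarith
      _ = ε * (r / 2) ^ 2 := by rw [he]; field_simp; norm_num
  filter_upwards [h₁, h₂] with x hx₁ hx₂
  rw [Real.dist_eq]
  have := abs_add_le ((x.1.2 : ℝ)⁻¹ * ∑ i : Fin x.1.2, f (x.2 i) - ∫ y, f y ∂(x.1.1.1 : Measure E))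
    ((∫ y, f y ∂(x.1.1.1 : Measure E)) - I)
  rw [sub_add_sub_cancel] at this
  linarith

/-- The uniform weak law of large numbers, for a function that is uniformly integrable. -/
theorem tendsto_mean_probFilter_of_uniformlyIntegrable [TopologicalSpace E] [BorelSpace E]
    (hP : ∀ (μ : Θ) (i : ℕ), (P μ : Measure (ℕ → E)).map (fun ω => ω i) = (μ.1 : Measure E))
    (hα : ∀ ε > 0, ∃ k₀ : ℕ, ∀ᶠ μ in l, ∀ k ≥ k₀, alphaMixing (P μ) k ≤ ε)
    (hl : l ≤ 𝓝 μ₁) {ψ : E → ℝ} (hψ : Continuous ψ) (hψ₀ : ∀ x, 0 ≤ ψ x)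
    (hint : Integrable ψ (μ₁.1 : Measure E))
    (hUI : ∀ ε > 0, ∃ a > 0, (∀ᶠ μ in l, ∫⁻ x in {x | a ≤ ψ x}, ENNReal.ofReal (ψ x)
        ∂(μ.1 : Measure E) ≤ ENNReal.ofReal ε) ∧
      ∫⁻ x in {x | a ≤ ψ x}, ENNReal.ofReal (ψ x) ∂(μ₁.1 : Measure E) ≤ ENNReal.ofReal ε) :
    Tendsto (fun x : (Θ × ℕ+) × (ℕ → E) => (x.1.2 : ℝ)⁻¹ * ∑ i : Fin x.1.2, ψ (x.2 i))
      (probFilter (fun i => P i.1) (l ×ˢ atTop)) (𝓝 (∫ x, ψ x ∂(μ₁.1 : Measure E))) := by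
  have hexc : ∀ a > 0, ∀ μ : Θ, ∫⁻ x, ENNReal.ofReal (ψ x - min (ψ x) a) ∂(μ.1 : Measure E) ≤
      ∫⁻ x in {x | a ≤ ψ x}, ENNReal.ofReal (ψ x) ∂(μ.1 : Measure E) := by
    intro a ha μ
    rw [← lintegral_indicator (measurableSet_le measurable_const hψ.measurable)]
    refine lintegral_mono fun x => ?_
    by_cases hx : a ≤ ψ x
    · simp only [Set.indicator, Set.mem_ofPred_eq, hx, if_true, min_eq_right]
      exact ENNReal.ofReal_le_ofReal (by linarith)
    · simp [Set.indicator, hx, min_eq_left (not_le.1 hx).le]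
  rw [Metric.tendsto_nhds]
  intro r hr
  have hmean : ∀ a > 0, ∀ᶠ x in probFilter (fun i : Θ × ℕ+ => P i.1) (l ×ˢ atTop),
      |(x.1.2 : ℝ)⁻¹ * ∑ i : Fin x.1.2, min (ψ (x.2 i)) a
        - ∫ y, min (ψ y) a ∂(μ₁.1 : Measure E)| < r / 3 := by
    intro a ha
    have hbd : ∀ x, |min (ψ x) a| ≤ a := fun x => by
      rw [abs_of_nonneg (le_min (hψ₀ x) ha.le)]; exact min_le_right _ _
    let g : BoundedContinuousFunction E ℝ :=
      BoundedContinuousFunction.ofNormedAddCommGroup (fun x => min (ψ x) a)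
        (hψ.min continuous_const) a hbd
    have hg : Tendsto (fun μ : Θ => ∫ x, g x ∂(μ.1 : Measure E)) l
        (𝓝 (∫ x, g x ∂(μ₁.1 : Measure E))) :=
      (((ProbabilityMeasure.continuous_integral_boundedContinuousFunction g).comp
        continuous_subtype_val).tendsto μ₁).mono_left hl
    exact Metric.tendsto_nhds.1 (tendsto_mean_probFilter hP hα
      (hψ.min continuous_const).measurable hbd hg) (r / 3) (by positivity)
  simp only [Real.dist_eq]
  refine eventually_probFilter_iff.2 fun ε hε => ?_
  -- The level `r / 4` bounds the truncation bias at `μ₁`, and `ε / 2 * (r / 3)` feeds Markov's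
  -- inequality for the mean excess over `a`. The total error stays below `r / 3 + r / 3 + r / 4 <
  -- r`.
  obtain ⟨a, ha, hae, ha₁⟩ := hUI (min (r / 4) (ε / 2 * (r / 3))) (by positivity)
  have hI₁ : |∫ y, min (ψ y) a ∂(μ₁.1 : Measure E) - ∫ y, ψ y ∂(μ₁.1 : Measure E)| ≤ r / 4 := by
    have hmin : Integrable (fun y => min (ψ y) a) (μ₁.1 : Measure E) :=
      hint.inf (integrable_const a)
    have h := (hexc a ha μ₁).trans (ha₁.trans (ENNReal.ofReal_le_ofReal (min_le_left _ _)))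
    rw [← ofReal_integral_eq_lintegral_ofReal (f := fun x => ψ x - min (ψ x) a) (hint.sub hmin)
      (.of_forall fun x => sub_nonneg.2 (min_le_left _ _)),
      ENNReal.ofReal_le_ofReal_iff (by positivity)] at h
    rw [abs_sub_comm, ← integral_sub hint hmin, abs_of_nonneg
      (integral_nonneg fun x => sub_nonneg.2 (min_le_left _ _))]
    exact h
  filter_upwards [eventually_probFilter_iff.1 (hmean a ha) (ε / 2) (by positivity),
    tendsto_fst.eventually hae] with i hi hai
  -- Only the marginals enter here, so no mixing is needed for the unbounded part; lower integrals
  -- avoid integrability under nearby laws.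
  have hmarkov : (P i.1 : Measure (ℕ → E)) {ω | ENNReal.ofReal (r / 3) ≤
      (i.2 : ℝ≥0∞)⁻¹ * ∑ j : Fin i.2, ENNReal.ofReal (ψ (ω j) - min (ψ (ω j)) a)} ≤
      ENNReal.ofReal (ε / 2) := by
    have hexm : Measurable fun x : E => ENNReal.ofReal (ψ x - min (ψ x) a) :=
      (hψ.sub (hψ.min continuous_const)).measurable.ennreal_ofReal
    have hexm' : ∀ j : Fin i.2, Measurable fun ω : ℕ → E =>
        ENNReal.ofReal (ψ (ω j) - min (ψ (ω j)) a) := fun j =>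
      hexm.comp (measurable_pi_apply (j : ℕ))
    refine (meas_ge_le_lintegral_div
      ((Finset.measurable_fun_sum _ fun j _ => hexm' j).const_mul _).aemeasurable
      (ENNReal.ofReal_pos.2 (by positivity)).ne' ENNReal.ofReal_ne_top).trans ?_
    refine ENNReal.div_le_of_le_mul ?_
    rw [lintegral_const_mul _ (Finset.measurable_fun_sum _ fun j _ => hexm' j),
      lintegral_finsetSum _ fun j _ => hexm' j]
    have hj : ∀ j : ℕ, ∫⁻ ω, ENNReal.ofReal (ψ (ω j) - min (ψ (ω j)) a)
        ∂(P i.1 : Measure (ℕ → E)) =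
        ∫⁻ x, ENNReal.ofReal (ψ x - min (ψ x) a) ∂(i.1.1 : Measure E) := fun j => by
      rw [← hP i.1 j, lintegral_map hexm (measurable_pi_apply j)]
    simp only [hj, Finset.sum_const, Finset.card_univ, Fintype.card_fin, nsmul_eq_mul]
    rw [← mul_assoc, ENNReal.inv_mul_cancel (by simp) (ENNReal.natCast_ne_top _), one_mul,
      ← ENNReal.ofReal_mul (by positivity)]
    exact (hexc a ha i.1).trans (hai.trans (ENNReal.ofReal_le_ofReal (min_le_right _ _)))
  refine (measure_mono fun ω hω => ?_).trans ((measure_union_le _ _).trans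
    ((add_le_add hi hmarkov).trans_eq (by
      rw [← ENNReal.ofReal_add (by positivity) (by positivity), add_halves])))
  by_contra hcon
  simp only [Set.mem_union, Set.mem_ofPred_eq, not_or, not_not, not_le] at hcon hω
  obtain ⟨hc₁, hc₂⟩ := hcon
  have hn : (0 : ℝ) < i.2 := by exact_mod_cast i.2.pos
  have hnn : ∀ j : Fin i.2, 0 ≤ ψ (ω j) - min (ψ (ω j)) a := fun j =>
    sub_nonneg.2 (min_le_left _ _)
  have hc₃ : (i.2 : ℝ)⁻¹ * ∑ j : Fin i.2, (ψ (ω j) - min (ψ (ω j)) a) < r / 3 := by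
    rw [← ENNReal.ofReal_sum_of_nonneg fun j _ => hnn j, ← ENNReal.ofReal_natCast,
      ← ENNReal.ofReal_inv_of_pos hn, ← ENNReal.ofReal_mul (by positivity)] at hc₂
    exact (ENNReal.ofReal_lt_ofReal_iff (by positivity)).1 hc₂
  have hc₄ : 0 ≤ (i.2 : ℝ)⁻¹ * ∑ j : Fin i.2, (ψ (ω j) - min (ψ (ω j)) a) :=
    mul_nonneg (by positivity) (Finset.sum_nonneg fun j _ => hnn j)
  rw [Finset.sum_sub_distrib, mul_sub] at hc₃ hc₄
  apply hω
  rw [abs_lt] at hc₁ ⊢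
  rw [abs_le] at hI₁
  constructor <;> linarith [hc₁.1, hc₁.2, hI₁.1, hI₁.2]

end Empirical

/-! ### Asymptotic robustness -/

theorem asymptoticallyRobust_plugInEstimator {E : Type*} [TopologicalSpace E]
    [MeasurableSpace E] [BorelSpace E] {S : Type*} [MetricSpace S] [MeasurableSpace S]
    [BorelSpace S] {ψ : E → ℝ} (hψ : Continuous ψ) (hψ₀ : ∀ x, 0 ≤ ψ x)
    {Θ : Set (ProbabilityMeasure E)} (hΘψ : Θ ⊆ probWithMoment ψ)
    (hΘ : ∀ (n : ℕ+) (x : Fin n → E), empiricalMeasure n x ∈ Θ)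
    {P : Θ → ProbabilityMeasure (ℕ → E)}
    (hP : ∀ (μ : Θ) (i : ℕ), (P μ : Measure (ℕ → E)).map (fun ω => ω i) = (μ.1 : Measure E))
    {T : ℕ+ → Θ → S} (hT : ∀ n, Measurable (plugInEstimator hΘ T n))
    {dw : ProbabilityMeasure E → ProbabilityMeasure E → ℝ} (hdw : Metrizes dw)
    {dΘ : Θ → Θ → ℝ} (hdΘ : Metrizes dΘ) {Θ₁ : Set Θ}
    (hα : ∀ μ₁ ∈ Θ₁, ∀ ε > 0, ∃ δ > 0, ∃ n₀ : ℕ, ∀ μ₂ ∈ Θ₁, dΘ μ₁ μ₂ ≤ δ →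
      ∀ n ≥ n₀, alphaMixing (P μ₂) n ≤ ε)
    (hcont : AsymptoticallyContinuous (fun μ₁ μ₂ : Θ => dPsi dw ψ μ₁ μ₂) dist T)
    (hUI : LocallyUniformlyIntegrating dΘ ψ Θ₁) :
    AsymptoticallyRobust dΘ prohorovDist P (plugInEstimator hΘ T) hT Θ₁ := by
  intro μ₁ h₁ ε hε
  set K := probFilter (fun i : Θ × ℕ+ => P i.1) (𝓝[Θ₁] μ₁ ×ˢ atTop)
  have hα' : ∀ ε > 0, ∃ k₀ : ℕ, ∀ᶠ μ in 𝓝[Θ₁] μ₁, ∀ k ≥ k₀, alphaMixing (P μ) k ≤ ε := by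
    intro ε hε
    obtain ⟨δ, hδ, n₀, h⟩ := hα μ₁ h₁ ε hε
    exact ⟨n₀, hdΘ.eventually_nhdsWithin_iff.2 ⟨δ, hδ, h⟩⟩
  have hweak : Tendsto (fun x : (Θ × ℕ+) × (ℕ → E) => empiricalMeasure x.1.2 (firstObs x.1.2 x.2))
      K (𝓝 μ₁.1) := by
    -- A weak neighbourhood involves finitely many test functions, so no uniformity in `f` is
    -- needed.
    rw [ProbabilityMeasure.tendsto_iff_forall_integral_tendsto]
    intro f
    simp_rw [integral_empiricalMeasure _ _ f.continuous.measurable]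
    refine tendsto_mean_probFilter hP hα' f.continuous.measurable f.norm_coe_le_norm ?_
    exact (((ProbabilityMeasure.continuous_integral_boundedContinuousFunction f).comp
      continuous_subtype_val).tendsto μ₁).mono_left nhdsWithin_le_nhds
  have hmom : Tendsto (fun x : (Θ × ℕ+) × (ℕ → E) =>
      ∫ y, ψ y ∂(empiricalMeasure x.1.2 (firstObs x.1.2 x.2) : Measure E))
      K (𝓝 (∫ y, ψ y ∂(μ₁.1 : Measure E))) := by
    simp_rw [integral_empiricalMeasure _ _ hψ.measurable]
    refine tendsto_mean_probFilter_of_uniformlyIntegrable hP hα' nhdsWithin_le_nhds hψ hψ₀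
      (hΘψ μ₁.2) fun ε hε => ?_
    obtain ⟨δ, hδ, a, ha, h⟩ := hUI μ₁ h₁ ε hε
    exact ⟨a, ha, hdΘ.eventually_nhdsWithin_iff.2 ⟨δ, hδ, h⟩,
      h μ₁ h₁ (by rw [hdΘ.self_eq_zero]; exact hδ.le)⟩
  obtain ⟨δ, hδ, n₀, hc⟩ := hcont μ₁ (ε / 2) (by positivity)
  have hclose : ∀ᶠ x in K, dist (plugInEstimator hΘ T x.1.2 x.2) (T x.1.2 μ₁) ≤ ε / 2 := by
    filter_upwards [hweak.eventually (hdw.eventually_le μ₁.1 (half_pos hδ)),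
      hmom.eventually (Metric.closedBall_mem_nhds _ (half_pos hδ)),
      eventually_probFilter_of_eventually (p := fun i : Θ × ℕ+ => n₀ ≤ i.2)
        (tendsto_snd.eventually (eventually_ge_atTop n₀))] with x hx₁ hx₂ hx₃
    rw [dist_comm]
    refine hc ⟨_, hΘ _ _⟩ ?_ _ hx₃
    rw [dist_comm, Real.dist_eq] at hx₂
    simp only [dPsi]
    linarith
  have hev := eventually_probFilter_iff.1 hclose (ε / 2) (by positivity)
  -- A product neighbourhood separates the radius `δ'` from the threshold `n₁`. Since `μ₁` is itself
  -- in the ball, the same estimate serves both laws.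
  obtain ⟨p, hp, q, hq, hpq⟩ := eventually_prod_iff.1 hev
  obtain ⟨δ', hδ', hp'⟩ := hdΘ.eventually_nhdsWithin_iff.1 hp
  obtain ⟨n₁, hn₁⟩ := eventually_atTop.1 hq
  refine ⟨δ', hδ', n₁, fun μ₂ h₂ hd n hn => ?_⟩
  have hball : ∀ μ ∈ Θ₁, dΘ μ₁ μ ≤ δ' →
      ((P μ).map (hT n).aemeasurable : Measure S) (Metric.closedBall (T n μ₁) (ε / 2))ᶜ ≤
        ENNReal.ofReal (ε / 2) := by
    intro μ hμ hdμ
    rw [ProbabilityMeasure.toMeasure_map, Measure.map_apply (hT n)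
      Metric.isClosed_closedBall.measurableSet.compl]
    exact hpq (hp' μ hμ hdμ) (hn₁ n hn)
  exact prohorovDist_le_of_closedBall hε
    (hball μ₁ h₁ (by rw [hdΘ.self_eq_zero]; exact hδ'.le)) (hball μ₂ h₂ hd)

end RobustPlugin

open RobustPlugin in
theorem mainTheorem6
    {E : Type*} [MetricSpace E] [CompleteSpace E] [SecondCountableTopology E]
    [MeasurableSpace E] [BorelSpace E]
    {S : Type*} [MetricSpace S] [CompleteSpace S] [SecondCountableTopology S]
    [MeasurableSpace S] [BorelSpace S]
    (ψ : E → ℝ) (hψ_cont : Continuous ψ) (hψ_one : ∀ x, 1 ≤ ψ x)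
    (Θ : Set (ProbabilityMeasure E)) (hΘψ : Θ ⊆ probWithMoment ψ)
    (hΘ : ∀ (n : ℕ+) (x : Fin n → E), empiricalMeasure n x ∈ Θ)
    (P : Θ → ProbabilityMeasure (ℕ → E))
    (hP : ∀ (μ : Θ) (i : ℕ),
      (P μ : Measure (ℕ → E)).map (fun ω => ω i) = ((μ : ProbabilityMeasure E) : Measure E))
    (T : ℕ+ → Θ → S) (hT : ∀ n, Measurable (plugInEstimator hΘ T n))
    (dw : ProbabilityMeasure E → ProbabilityMeasure E → ℝ) (hdw : Metrizes dw)
    (dΘ : Θ → Θ → ℝ) (hdΘ : Metrizes dΘ)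
    (ρ : ProbabilityMeasure S → ProbabilityMeasure S → ℝ) (hρ : Metrizes ρ)
    (ρn : ∀ n : ℕ+, ProbabilityMeasure (Fin n → E) → ProbabilityMeasure (Fin n → E) → ℝ)
    (hρn : ∀ n, Metrizes (ρn n)) :
    -- (i)
    (LocallyCompactSpace E →
      ∀ Θ₀ : Set Θ,
        (∀ μ₁ ∈ Θ₀, ∀ ε > 0, ∃ δ > 0, ∃ n₀ : ℕ, ∀ μ₂ ∈ Θ₀, dΘ μ₁ μ₂ ≤ δ →
          ∀ n ≥ n₀, alphaMixing (P μ₂) n ≤ ε) →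
        AsymptoticallyContinuous (fun μ₁ μ₂ : Θ => dPsi dw ψ μ₁ μ₂) dist T →
        ∀ Θ₁ ⊆ Θ₀, LocallyUniformlyIntegrating dΘ ψ Θ₁ →
          AsymptoticallyRobust dΘ prohorovDist P (plugInEstimator hΘ T) hT Θ₁) ∧
    -- (ii)
    (∀ Θ₀ : Set Θ,
      (∀ n : ℕ+, MetricContinuous (fun μ₁ μ₂ : Θ₀ => dΘ μ₁ μ₂) (ρn n)
        (fun μ : Θ₀ => (P μ).map (measurable_firstObs n).aemeasurable)) →
      (∀ n : ℕ+, Continuous (plugInMap hΘ T n)) →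
      FiniteSampleRobust dΘ ρ P (plugInEstimator hΘ T) hT Θ₀) ∧
    -- (iii)
    (∀ Θ₀ : Set Θ,
      AsymptoticallyRobust dΘ ρ P (plugInEstimator hΘ T) hT Θ₀ →
      ∀ T₀ : Θ₀ → S,
        (∀ η > 0, ∀ μ : Θ₀,
          Tendsto (fun n : ℕ+ => (P μ : Measure (ℕ → E))
            {ω | η ≤ dist (plugInEstimator hΘ T n ω) (T₀ μ)}) atTop (𝓝 0)) →
        MetricContinuous (fun μ₁ μ₂ : Θ₀ => dΘ μ₁ μ₂) dist T₀) := by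
  refine ⟨fun _ Θ₀ hα hcont Θ₁ hsub hUI => ?_, fun Θ₀ hPn ht => ?_, fun Θ₀ hrob T₀ hcons => ?_⟩
  · refine asymptoticallyRobust_plugInEstimator hψ_cont (fun x => zero_le_one.trans (hψ_one x))
      hΘψ hΘ hP hT hdw hdΘ (fun μ₁ h₁ ε hε => ?_) hcont hUI
    obtain ⟨δ, hδ, n₀, h⟩ := hα μ₁ (hsub h₁) ε hε
    exact ⟨δ, hδ, n₀, fun μ₂ h₂ => h μ₂ (hsub h₂)⟩
  · exact finiteSampleRobust_of_continuous hρ hρn hT hPn ht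
  · exact metricContinuous_of_asymptoticallyRobust hρ hT hrob T₀ hcons
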